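/- A unit weighing matrix $UW(n,p)$ is an $n\times n$ complex matrix $W$ whose entries all have modulus $0$ or $1$ and which satisfies $WW^*=pI_n$; it is a real weighing matrix $W(n,p)$ if its entries lie in $\{0,1,-1\}$. Two $UW(n,p)$ $H,K$ are unbiased if $HK^*=\sqrt p\,L$ for some $UW(n,p)$ $L$; a set of $UW(n,p)$ is mutually unbiased if any two distinct members are unbiased. $H$ and $K$ are equivalent if $H=PKQ$ with $P,Q$ matrices having exactly one nonzero entry in each row and in each column, that entry being unimodular. Let $W_7=W^{(1)},W^{(2)},\dots,W^{(8)}$ be the $7\times7$ matrices with the following rows (listed from top to bottom, with $+$ for $1$ and $-$ for $-1$): - $W_7=W^{(1)}$: $++++000,\ +-00++0,\ +0-0-0+,\ +00-0--,\ 0+-00+-,\ 0+0-+0+,\ 00+--+0$ - $W^{(2)}$: $++--000,\ +-00-+0,\ +0+0+0+,\ +00+0--,\ 0++00+-,\ 0+0+-0+,\ 00+---0$ - $W^{(3)}$: $++00--0,\ +-+-000,\ +0-0+0+,\ +00+0+-,\ 0++00++,\ 0+0-+0-,\ 00+++-0$ - $W^{(4)}$: $++00++0,\ +---000,\ +0+0-0-,\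 +00+0-+,\ 0+-00--,\ 0+0--0+,\ 00+-+-0$ - $W^{(5)}$: $+++-000,\ +-00+-0,\ +0-0-0-,\ +00+0++,\ 0+-00-+,\ 0+0++0-,\ 00++--0$ - $W^{(6)}$: $++00+-0,\ +--+000,\ +0+0-0+,\ +00-0+-,\ 0+-00++,\ 0+0+-0-,\ 00++++0$ - $W^{(7)}$: $++-+000,\ +-00--0,\ +0+0+0-,\ +00-0++,\ 0++00-+,\ 0+0--0-,\ 00++-+0$ - $W^{(8)}$: $++00-+0,\ +-++000,\ +0-0+0-,\ +00-0-+,\ 0++00--,\ 0+0++0+,\ 00+-++0$ Theorem. The maximum number of mutually unbiased $UW(7,4)$ is $8$. Moreover: 1. $W_7$ is a real $W(7,4)$, and every $UW(7,4)$ is equivalent to $W_7$. 2. If $W$ is a $UW(7,4)$ that is unbiased with $W_7$, then $W$ is real up to multiplying its rows by unimodular numbers: there is a diagonal matrix $D$ with unimodular diagonal entries such that $DW$ is a real $W(7,4)$. 3. Every set $S$ of mutually unbiased $UW(7,4)$ is finite and satisfies the bound for real weighing matrices, $|S|\le \frac{(n-1)w}{3w-(n+2)}$ with $n=7$, $w=4$,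 and the value of this bound is $8$. 4. $\{W^{(1)},\dots,W^{(8)}\}$ is a set of $8$ distinct, mutually unbiased real $W(7,4)$, so it attains the bound. -/

import Mathlib

open scoped Matrix

/-- `W` is a unit weighing matrix `UW(n, p)`: every entry has modulus `0` or `1`, and
`W W* = p I`. -/
def IsUnitWeighing {n : ℕ} (p : ℕ) (W : Matrix (Fin n) (Fin n) ℂ) : Prop :=
  (∀ i j, ‖W i j‖ = 0 ∨ ‖W i j‖ = 1) ∧ W * Wᴴ = (p : ℂ) • (1 : Matrix (Fin n) (Fin n) ℂ)

/-- `W` is a real weighing matrix `W(n, p)`: a weighing matrix with entries in `{0, 1, -1}`. -/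
def IsRealWeighing {n : ℕ} (p : ℕ) (W : Matrix (Fin n) (Fin n) ℂ) : Prop :=
  IsUnitWeighing p W ∧ ∀ i j, W i j = 0 ∨ W i j = 1 ∨ W i j = -1

/-- Two matrices `UW(n, p)`, `H` and `K`, are unbiased if `H K* = √p L` for some `UW(n, p)` `L`. -/
def IsUnbiased {n : ℕ} (p : ℕ) (H K : Matrix (Fin n) (Fin n) ℂ) : Prop :=
  IsUnitWeighing p H ∧ IsUnitWeighing p K ∧
    ∃ L : Matrix (Fin n) (Fin n) ℂ, IsUnitWeighing p L ∧ H * Kᴴ = ((Real.sqrt p : ℝ) : ℂ) • L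

/-- A set of mutually unbiased unit weighing matrices `UW(n, p)`. -/
def IsMutuallyUnbiased {n : ℕ} (p : ℕ) (S : Set (Matrix (Fin n) (Fin n) ℂ)) : Prop :=
  (∀ W ∈ S, IsUnitWeighing p W) ∧ S.Pairwise (IsUnbiased p)

/-- Unimodular permutation matrices: each row and each column has exactly one nonzero entry, and
the nonzero entries are unimodular. -/
def IsUnimodularPerm {n : ℕ} (P : Matrix (Fin n) (Fin n) ℂ) : Prop :=
  (∀ i, ∃! j, P i j ≠ 0) ∧ (∀ j, ∃! i, P i j ≠ 0) ∧ ∀ i j, P i j ≠ 0 → ‖P i j‖ = 1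

/-- `H` and `K` are equivalent if `H = P K Q` with `P`, `Q` unimodular permutation matrices. -/
def IsWeighingEquiv {n : ℕ} (H K : Matrix (Fin n) (Fin n) ℂ) : Prop :=
  ∃ P Q : Matrix (Fin n) (Fin n) ℂ, IsUnimodularPerm P ∧ IsUnimodularPerm Q ∧ H = P * K * Q

/-- The bound `(n - 1) w / (3 w - (n + 2))` for real mutually unbiased weighing matrices of order
`n` and weight `w`; it is meaningful when the denominator is positive. -/
noncomputable def realUnbiasedBound (n w : ℕ) : ℝ :=
  (((n : ℝ) - 1) * (w : ℝ)) / (3 * (w : ℝ) - ((n : ℝ) + 2))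

/-- Eight integer matrices of order 7; the first one is `W₇`. -/
def family74Int : Fin 8 → Matrix (Fin 7) (Fin 7) ℤ :=
  ![!![1, 1, 1, 1, 0, 0, 0;
     1, -1, 0, 0, 1, 1, 0;
     1, 0, -1, 0, -1, 0, 1;
     1, 0, 0, -1, 0, -1, -1;
     0, 1, -1, 0, 0, 1, -1;
     0, 1, 0, -1, 1, 0, 1;
     0, 0, 1, -1, -1, 1, 0],
    !![1, 1, -1, -1, 0, 0, 0;
     1, -1, 0, 0, -1, 1, 0;
     1, 0, 1, 0, 1, 0, 1;
     1, 0, 0, 1, 0, -1, -1;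
     0, 1, 1, 0, 0, 1, -1;
     0, 1, 0, 1, -1, 0, 1;
     0, 0, 1, -1, -1, -1, 0],
    !![1, 1, 0, 0, -1, -1, 0;
     1, -1, 1, -1, 0, 0, 0;
     1, 0, -1, 0, 1, 0, 1;
     1, 0, 0, 1, 0, 1, -1;
     0, 1, 1, 0, 0, 1, 1;
     0, 1, 0, -1, 1, 0, -1;
     0, 0, 1, 1, 1, -1, 0],
    !![1, 1, 0, 0, 1, 1, 0;
     1, -1, -1, -1, 0, 0, 0;
     1, 0, 1, 0, -1, 0, -1;
     1, 0, 0, 1, 0, -1, 1;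
     0, 1, -1, 0, 0, -1, -1;
     0, 1, 0, -1, -1, 0, 1;
     0, 0, 1, -1, 1, -1, 0],
    !![1, 1, 1, -1, 0, 0, 0;
     1, -1, 0, 0, 1, -1, 0;
     1, 0, -1, 0, -1, 0, -1;
     1, 0, 0, 1, 0, 1, 1;
     0, 1, -1, 0, 0, -1, 1;
     0, 1, 0, 1, 1, 0, -1;
     0, 0, 1, 1, -1, -1, 0],
    !![1, 1, 0, 0, 1, -1, 0;
     1, -1, -1, 1, 0, 0, 0;
     1, 0, 1, 0, -1, 0, 1;
     1, 0, 0, -1, 0, 1, -1;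
     0, 1, -1, 0, 0, 1, 1;
     0, 1, 0, 1, -1, 0, -1;
     0, 0, 1, 1, 1, 1, 0],
    !![1, 1, -1, 1, 0, 0, 0;
     1, -1, 0, 0, -1, -1, 0;
     1, 0, 1, 0, 1, 0, -1;
     1, 0, 0, -1, 0, 1, 1;
     0, 1, 1, 0, 0, -1, 1;
     0, 1, 0, -1, -1, 0, -1;
     0, 0, 1, 1, -1, 1, 0],
    !![1, 1, 0, 0, -1, 1, 0;
     1, -1, 1, 1, 0, 0, 0;
     1, 0, -1, 0, 1, 0, -1;
     1, 0, 0, -1, 0, -1, 1;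
     0, 1, 1, 0, 0, -1, -1;
     0, 1, 0, 1, 1, 0, 1;
     0, 0, 1, -1, 1, 1, 0]]

/-- The eight matrices, with complex entries. -/
def family74 (k : Fin 8) : Matrix (Fin 7) (Fin 7) ℂ :=
  (family74Int k).map (fun z : ℤ => (z : ℂ))

/-- The matrix `W₇`. -/
def matrixW7 : Matrix (Fin 7) (Fin 7) ℂ :=
  family74 0

/-! Two rows of a `UW(7,4)` have supports of size 4 in 7 points, so they meet; a single common
position would leave one nonzero term in a vanishing inner product. Double counting then makes every
intersection exactly 2, so the zeros form a Fano plane, whose uniqueness fixes the zero pattern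
(`exists_fano_labelling`). Orthogonality of two rows involves just two columns, which makes the
entrywise quotient by `W₇` of rank one on the support: phases of rows and columns carry `W₇` to any
`UW(7,4)` (`IsUnitWeighing.exists_scaling`).

A row of a matrix unbiased with `W₇` has inner products of modulus 0 or 2 with the rows of `W₇`. A
finite check on 4-subsets forces its support to be that of a row of `W₇`, and any two of its nonzero
entries to agree up to sign (`vecSupport_eq_and_real_of_norm_dotProduct`).

For the bound, normalise one member to `W₇`. Each member then has a row supported on the first four
columns, determined up to phase by three signs. Two members sharing these signs would have rows with
inner product of modulus 4, so there are at most `2 ^ 3` members. The explicit family realises each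
sign pattern once. The real bound is simply 8 evaluated; no separate argument is needed for it. -/

section UnitWeighing

variable {W : Matrix (Fin 7) (Fin 7) ℂ}

/-! ### Supports of rows and columns -/

/-- A one-sided inverse of a square matrix is two-sided. This transfers every fact about rows to
columns. -/
theorem IsUnitWeighing.conjTranspose {n p : ℕ} {W : Matrix (Fin n) (Fin n) ℂ} (hp : p ≠ 0)
    (h : IsUnitWeighing p W) : IsUnitWeighing p Wᴴ := by
  refine ⟨fun i j => by simpa using h.1 j i, ?_⟩
  have hp' : (p : ℂ) ≠ 0 := by exact_mod_cast hp
  have h1 : ((p : ℂ)⁻¹ • Wᴴ) * W = 1 := by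
    rw [mul_eq_one_comm, Matrix.mul_smul, h.2, smul_smul, inv_mul_cancel₀ hp', one_smul]
  rw [Matrix.conjTranspose_conjTranspose]
  rw [Matrix.smul_mul] at h1
  rw [← h1, smul_smul, mul_inv_cancel₀ hp', one_smul]

theorem IsUnitWeighing.norm_eq_one {n p : ℕ} {W : Matrix (Fin n) (Fin n) ℂ}
    (h : IsUnitWeighing p W) {i j : Fin n} (hij : W i j ≠ 0) : ‖W i j‖ = 1 :=
  (h.1 i j).resolve_left (by simpa using hij)

theorem IsUnitWeighing.sum_mul_star {n p : ℕ} {W : Matrix (Fin n) (Fin n) ℂ}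
    (h : IsUnitWeighing p W) (i j : Fin n) :
    ∑ k, W i k * star (W j k) = if i = j then (p : ℂ) else 0 := by
  have := congrFun (congrFun h.2 i) j
  simpa [Matrix.mul_apply, Matrix.one_apply] using this

/-- The set of positions of the nonzero entries of a vector. -/
noncomputable def vecSupport {n : ℕ} (x : Fin n → ℂ) : Finset (Fin n) :=
  Finset.univ.filter fun j => x j ≠ 0

theorem mem_vecSupport {n : ℕ} {x : Fin n → ℂ} {j : Fin n} : j ∈ vecSupport x ↔ x j ≠ 0 := by
  simp [vecSupport]

theorem mul_star_self_of_norm {z : ℂ} (h : ‖z‖ = 1) : z * star z = 1 := by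
  simp [Complex.mul_conj, Complex.normSq_eq_norm_sq, h]

theorem IsUnitWeighing.card_support {n p : ℕ} {W : Matrix (Fin n) (Fin n) ℂ}
    (h : IsUnitWeighing p W) (i : Fin n) : (vecSupport (W i)).card = p := by
  have h1 := h.sum_mul_star i i
  have h2 : ∑ k, W i k * star (W i k) = ∑ k ∈ vecSupport (W i), (1 : ℂ) := by
    rw [vecSupport, Finset.sum_filter]
    refine Finset.sum_congr rfl fun k _ => ?_
    split_ifs with hk
    · exact mul_star_self_of_norm (h.norm_eq_one hk)
    · simp [not_not.1 hk]
  rw [h2] at h1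
  simpa using h1

theorem IsUnitWeighing.card_inter_ne_one {n p : ℕ} {W : Matrix (Fin n) (Fin n) ℂ}
    (h : IsUnitWeighing p W) {i j : Fin n} (hij : i ≠ j) :
    (vecSupport (W i) ∩ vecSupport (W j)).card ≠ 1 := by
  intro hc
  obtain ⟨k, hk⟩ := Finset.card_eq_one.1 hc
  have h1 := h.sum_mul_star i j
  rw [if_neg hij, Finset.sum_eq_single k] at h1
  · have : k ∈ vecSupport (W i) ∩ vecSupport (W j) := by simp [hk]
    simp only [Finset.mem_inter, mem_vecSupport] at this
    simp [this.1, this.2] at h1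
  · intro l _ hl
    by_contra hne
    have : l ∈ vecSupport (W i) ∩ vecSupport (W j) := by
      simp only [Finset.mem_inter, mem_vecSupport]
      constructor <;> intro h0 <;> simp [h0] at hne
    rw [hk] at this
    exact hl (by simpa using this)
  · simp

theorem IsUnitWeighing.card_inter (h : IsUnitWeighing 4 W) {i j : Fin 7} (hij : i ≠ j) :
    (vecSupport (W i) ∩ vecSupport (W j)).card = 2 := by
  have hge : ∀ k ∈ Finset.univ.erase i, 2 ≤ (vecSupport (W i) ∩ vecSupport (W k)).card := by
    intro k hk
    have h1 := Finset.card_union_add_card_inter (vecSupport (W i)) (vecSupport (W k))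
    have h2 := Finset.card_le_univ (vecSupport (W i) ∪ vecSupport (W k))
    rw [h.card_support, h.card_support] at h1
    have h3 := h.card_inter_ne_one (Finset.ne_of_mem_erase hk).symm
    simp only [Fintype.card_fin] at h2
    omega
  have hsum : ∑ k ∈ Finset.univ.erase i, (vecSupport (W i) ∩ vecSupport (W k)).card
      = ∑ _k ∈ (Finset.univ : Finset (Fin 7)).erase i, 2 := by
    -- Each of the 4 columns in the support of row `i` has 4 nonzero entries. Removing the term `k =
    -- i` leaves 12 for six intersections of size at least 2, so all are equalities.
    have htot : ∑ k, (vecSupport (W i) ∩ vecSupport (W k)).card = 16 := by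
      have hcol : ∀ c, (Finset.univ.filter fun k => W k c ≠ 0).card = 4 := by
        intro c
        have := (h.conjTranspose (by norm_num)).card_support c
        simpa [vecSupport] using this
      have : ∀ k, (vecSupport (W i) ∩ vecSupport (W k)).card
          = ∑ c ∈ vecSupport (W i), if W k c ≠ 0 then 1 else 0 := by
        intro k
        rw [Finset.card_eq_sum_ones, ← Finset.sum_filter]
        refine Finset.sum_congr ?_ fun _ _ => rfl
        ext c
        simp [mem_vecSupport]
      simp_rw [this]
      rw [Finset.sum_comm]
      have : ∀ c, (∑ k, if W k c ≠ 0 then 1 else 0) = 4 := by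
        intro c
        rw [← hcol c, Finset.card_eq_sum_ones, Finset.sum_filter]
      simp only [this, Finset.sum_const, h.card_support i, smul_eq_mul]
    rw [← Finset.add_sum_erase _ _ (Finset.mem_univ i), Finset.inter_self,
      h.card_support] at htot
    simp only [Finset.sum_const, Finset.card_erase_of_mem (Finset.mem_univ i), Finset.card_univ,
      Fintype.card_fin, smul_eq_mul]
    omega
  exact ((Finset.sum_eq_sum_iff_of_le hge).1 hsum.symm j
    (Finset.mem_erase.2 ⟨hij.symm, Finset.mem_univ _⟩)).symm

theorem IsUnitWeighing.card_zeros (h : IsUnitWeighing 4 W) (i : Fin 7) :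
    (Finset.univ.filter fun j => W i j = 0).card = 3 := by
  have h1 := Finset.card_filter_add_card_filter_not (s := Finset.univ) (fun j => W i j = 0)
  have h2 := h.card_support i
  rw [vecSupport] at h2
  simp only [Finset.card_univ, Fintype.card_fin] at h1
  simp only [ne_eq] at h2
  omega

theorem IsUnitWeighing.card_common_zeros (h : IsUnitWeighing 4 W) {i j : Fin 7} (hij : i ≠ j) :
    (Finset.univ.filter fun k => W i k = 0 ∧ W j k = 0).card = 1 := by
  have h1 := Finset.card_union_add_card_inter (vecSupport (W i)) (vecSupport (W j))
  rw [h.card_support, h.card_support, h.card_inter hij] at h1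
  have h2 := Finset.card_compl (vecSupport (W i) ∪ vecSupport (W j))
  have h3 : (vecSupport (W i) ∪ vecSupport (W j))ᶜ
      = Finset.univ.filter fun k => W i k = 0 ∧ W j k = 0 := by
    ext k
    simp [mem_vecSupport]
  rw [h3] at h2
  simp only [Fintype.card_fin] at h2
  omega

/-- Rows become lines and columns points, with incidence at the zeros; this is the line through two
points. -/
theorem IsUnitWeighing.exists_common_zero_row (h : IsUnitWeighing 4 W) {j k : Fin 7}
    (hjk : j ≠ k) : ∃ i, W i j = 0 ∧ W i k = 0 := by
  have := (h.conjTranspose (by norm_num)).card_common_zeros hjk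
  obtain ⟨i, hi⟩ := Finset.card_pos.1 (this ▸ Nat.one_pos)
  exact ⟨i, by simpa using hi⟩

theorem IsUnitWeighing.common_zeros_unique (h : IsUnitWeighing 4 W) {i j k l : Fin 7}
    (h1 : W i k = 0) (h2 : W i l = 0) (h3 : W j k = 0) (h4 : W j l = 0) (hkl : k ≠ l) : i = j := by
  by_contra hij
  exact hkl (Finset.card_le_one.1 (h.card_common_zeros hij).le k (by simp [h1, h3]) l
    (by simp [h2, h4]))

end UnitWeighing

/-! ### Uniqueness of the Fano plane -/

/-- The entries of `W₇` as integers. -/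
def w7Entry (i j : Fin 7) : ℤ := family74Int 0 i j

/-- Every Steiner triple system on seven points can be labelled as the zero pattern of `W₇`. -/
theorem exists_fano_labelling (I : Fin 7 → Fin 7 → Prop) [∀ i j, Decidable (I i j)]
    (hcard : ∀ i, (Finset.univ.filter (I i)).card = 3)
    (hline : ∀ j k, j ≠ k → ∃ i, I i j ∧ I i k)
    (huniq : ∀ i j k l, I i k → I i l → I j k → I j l → k ≠ l → i = j) :
    ∃ τ σ : Equiv.Perm (Fin 7), ∀ i j, I (τ i) (σ j) ↔ w7Entry i j = 0 := by
  have third : ∀ x y, x ≠ y → ∃ i z, z ≠ x ∧ z ≠ y ∧ ∀ w, I i w ↔ w = x ∨ w = y ∨ w = z := by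
    intro x y hxy
    obtain ⟨i, hx, hy⟩ := hline x y hxy
    have hsub : ({x, y} : Finset (Fin 7)) ⊆ Finset.univ.filter (I i) := by
      intro w hw
      simp only [Finset.mem_insert, Finset.mem_singleton] at hw
      rcases hw with rfl | rfl <;> simpa
    have hc : (Finset.univ.filter (I i) \ {x, y}).card = 1 := by
      rw [Finset.card_sdiff_of_subset hsub, hcard, Finset.card_pair hxy]
    obtain ⟨z, hz⟩ := Finset.card_eq_one.1 hc
    have hw : ∀ w, (I i w ∧ ¬(w = x ∨ w = y)) ↔ w = z := by
      intro w
      have := Finset.ext_iff.1 hz w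
      simpa using this
    refine ⟨i, z, ?_, ?_, ?_⟩
    · have := (hw z).2 rfl; tauto
    · have := (hw z).2 rfl; tauto
    · intro w
      have := hw w
      constructor
      · intro h; tauto
      · rintro (rfl | rfl | rfl)
        · exact hx
        · exact hy
        · exact ((hw w).2 rfl).1
  -- The labelling starts from a line `{p4, p5, p6}` and a point `p3` off it; the three joins of
  -- `p3` to that line supply `p0`, `p1`, `p2`. Indices follow the zeros of `W₇`.
  obtain ⟨p4, p5, h45⟩ : ∃ x y : Fin 7, x ≠ y := ⟨0, 1, by decide⟩
  obtain ⟨r0, p6, h64, h65, hr0⟩ := third p4 p5 h45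
  obtain ⟨p3, hp3⟩ : ∃ p3, ¬ I r0 p3 := by
    by_contra! hall
    have := hcard r0
    simp [hall] at this
  have hp3' := hp3
  rw [hr0] at hp3'
  push Not at hp3'
  obtain ⟨h34, h35, h36⟩ := hp3'
  obtain ⟨r4, p0, h03, h04, hr4⟩ := third p3 p4 h34
  obtain ⟨r2, p1, h13, h15, hr2⟩ := third p3 p5 h35
  obtain ⟨r1, p2, h23, h26, hr1⟩ := third p3 p6 h36
  -- A line through `p3` meets `r0` at most once, since two common points would make it equal to
  -- `r0`, which misses `p3`.
  have off : ∀ i x, x = p4 ∨ x = p5 ∨ x = p6 → I i x → I i p3 →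
      ∀ z, z ≠ x → I i z → z ≠ p4 ∧ z ≠ p5 ∧ z ≠ p6 := by
    intro i x hx h1 h2 z hz h3
    have : ¬ I r0 z := fun h =>
      hp3 (huniq i r0 x z h1 h3 ((hr0 x).2 hx) h hz.symm ▸ h2)
    rw [hr0] at this
    push Not at this
    exact this
  obtain ⟨-, h05, h06⟩ := off r4 p4 (by simp) (by simp [hr4]) (by simp [hr4]) p0 h04 (by simp [hr4])
  obtain ⟨h14, -, h16⟩ := off r2 p5 (by simp) (by simp [hr2]) (by simp [hr2]) p1 h15 (by simp [hr2])
  obtain ⟨h24, h25, -⟩ := off r1 p6 (by simp) (by simp [hr1]) (by simp [hr1]) p2 h26 (by simp [hr1])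
  have h01 : p0 ≠ p1 := by
    rintro rfl
    have := huniq r4 r2 p3 p0 (by simp [hr4]) (by simp [hr4]) (by simp [hr2]) (by simp [hr2]) h03.symm
    have h := (hr2 p4).1 (this ▸ (hr4 p4).2 (by simp))
    grind
  have h02 : p0 ≠ p2 := by
    rintro rfl
    have := huniq r4 r1 p3 p0 (by simp [hr4]) (by simp [hr4]) (by simp [hr1]) (by simp [hr1]) h03.symm
    have h := (hr1 p4).1 (this ▸ (hr4 p4).2 (by simp))
    grind
  have h12 : p1 ≠ p2 := by
    rintro rfl
    have := huniq r2 r1 p3 p1 (by simp [hr2]) (by simp [hr2]) (by simp [hr1]) (by simp [hr1]) h13.symm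
    have h := (hr1 p5).1 (this ▸ (hr2 p5).2 (by simp))
    grind
  have hsurj : ∀ w, w = p0 ∨ w = p1 ∨ w = p2 ∨ w = p3 ∨ w = p4 ∨ w = p5 ∨ w = p6 := by
    have hc : ({p0, p1, p2, p3, p4, p5, p6} : Finset (Fin 7)).card = 7 := by
      repeat rw [Finset.card_insert_of_notMem
        (by simp only [Finset.mem_insert, Finset.mem_singleton]; tauto)]
      simp
    have := Finset.eq_univ_of_card _ hc
    intro w
    have hw := Finset.mem_univ w
    rw [← this] at hw
    simpa using hw
  -- The third point of the line `xy` cannot lie on another line through `x` or `y`; three such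
  -- lines cover everything but `z'`.
  have close : ∀ x y a b c z', x ≠ y → I a x → ¬ I a y → I b x → ¬ I b y → I c y → ¬ I c x →
      (∀ w, I a w ∨ I b w ∨ I c w ∨ w = z') → ∃ i, ∀ w, I i w ↔ w = x ∨ w = y ∨ w = z' := by
    intro x y a b c z' hxy hax hay hbx hby hcy hcx hall
    obtain ⟨i, z, hzx, hzy, hi⟩ := third x y hxy
    have hix : I i x := (hi x).2 (by simp)
    have hiy : I i y := (hi y).2 (by simp)
    have hiz : I i z := (hi z).2 (by simp)
    have haz : ¬ I a z := fun h => hay (huniq i a x z hix hiz hax h hzx.symm ▸ hiy)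
    have hbz : ¬ I b z := fun h => hby (huniq i b x z hix hiz hbx h hzx.symm ▸ hiy)
    have hcz : ¬ I c z := fun h => hcx (huniq i c y z hiy hiz hcy h hzy.symm ▸ hix)
    have : z = z' := by
      rcases hall z with h | h | h | h <;> tauto
    exact ⟨i, this ▸ hi⟩
  obtain ⟨r3, hr3⟩ := close p4 p1 r0 r4 r2 p2 (by tauto) (by grind) (by grind) (by grind)
    (by grind) (by grind) (by grind) (by intro w; rw [hr0, hr4, hr2]; have := hsurj w; tauto)
  obtain ⟨r5, hr5⟩ := close p5 p0 r0 r2 r4 p2 (by tauto) (by grind) (by grind) (by grind)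
    (by grind) (by grind) (by grind) (by intro w; rw [hr0, hr2, hr4]; have := hsurj w; tauto)
  obtain ⟨r6, hr6⟩ := close p6 p0 r0 r1 r4 p1 (by tauto) (by grind) (by grind) (by grind)
    (by grind) (by grind) (by grind) (by intro w; rw [hr0, hr1, hr4]; have := hsurj w; tauto)
  have hσ : Function.Bijective ![p0, p1, p2, p3, p4, p5, p6] := by
    rw [← Finite.surjective_iff_bijective]
    intro w
    rcases hsurj w with h | h | h | h | h | h | h
    exacts [⟨0, h.symm⟩, ⟨1, h.symm⟩, ⟨2, h.symm⟩, ⟨3, h.symm⟩, ⟨4, h.symm⟩, ⟨5, h.symm⟩, ⟨6, h.symm⟩]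
  have htab : ∀ i w, I (![r0, r1, r2, r3, r4, r5, r6] i) (![p0, p1, p2, p3, p4, p5, p6] w) ↔
      w7Entry i w = 0 := by
    have hp : ∀ a b, ![p0, p1, p2, p3, p4, p5, p6] a = ![p0, p1, p2, p3, p4, p5, p6] b ↔ a = b :=
      fun a b => hσ.1.eq_iff
    have q0 : ∀ w, I r0 (![p0, p1, p2, p3, p4, p5, p6] w) ↔ w = 4 ∨ w = 5 ∨ w = 6 := by
      intro w
      rw [hr0, ← hp w 4, ← hp w 5, ← hp w 6]
      rfl
    have q1 : ∀ w, I r1 (![p0, p1, p2, p3, p4, p5, p6] w) ↔ w = 3 ∨ w = 6 ∨ w = 2 := by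
      intro w
      rw [hr1, ← hp w 3, ← hp w 6, ← hp w 2]
      rfl
    have q2 : ∀ w, I r2 (![p0, p1, p2, p3, p4, p5, p6] w) ↔ w = 3 ∨ w = 5 ∨ w = 1 := by
      intro w
      rw [hr2, ← hp w 3, ← hp w 5, ← hp w 1]
      rfl
    have q3 : ∀ w, I r3 (![p0, p1, p2, p3, p4, p5, p6] w) ↔ w = 4 ∨ w = 1 ∨ w = 2 := by
      intro w
      rw [hr3, ← hp w 4, ← hp w 1, ← hp w 2]
      rfl
    have q4 : ∀ w, I r4 (![p0, p1, p2, p3, p4, p5, p6] w) ↔ w = 3 ∨ w = 4 ∨ w = 0 := by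
      intro w
      rw [hr4, ← hp w 3, ← hp w 4, ← hp w 0]
      rfl
    have q5 : ∀ w, I r5 (![p0, p1, p2, p3, p4, p5, p6] w) ↔ w = 5 ∨ w = 0 ∨ w = 2 := by
      intro w
      rw [hr5, ← hp w 5, ← hp w 0, ← hp w 2]
      rfl
    have q6 : ∀ w, I r6 (![p0, p1, p2, p3, p4, p5, p6] w) ↔ w = 6 ∨ w = 0 ∨ w = 1 := by
      intro w
      rw [hr6, ← hp w 6, ← hp w 0, ← hp w 1]
      rfl
    intro i w
    match i with
    | 0 => exact (q0 w).trans (by revert w; decide)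
    | 1 => exact (q1 w).trans (by revert w; decide)
    | 2 => exact (q2 w).trans (by revert w; decide)
    | 3 => exact (q3 w).trans (by revert w; decide)
    | 4 => exact (q4 w).trans (by revert w; decide)
    | 5 => exact (q5 w).trans (by revert w; decide)
    | 6 => exact (q6 w).trans (by revert w; decide)
  have hτ : Function.Bijective ![r0, r1, r2, r3, r4, r5, r6] := by
    rw [← Finite.injective_iff_bijective]
    intro a b hab
    have hrows : ∀ a b : Fin 7, a ≠ b → ∃ w,
        ¬ (w7Entry a w = 0 ↔ w7Entry b w = 0) := by
      decide
    by_contra hne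
    obtain ⟨w, hw⟩ := hrows a b hne
    exact hw (by rw [← htab, ← htab, hab])
  exact ⟨Equiv.ofBijective _ hτ, Equiv.ofBijective _ hσ, htab⟩

/-! ### Uniqueness of the phases -/

theorem w7Entry_cases : ∀ i j, w7Entry i j = 0 ∨ w7Entry i j = 1 ∨ w7Entry i j = -1 := by
  decide

theorem w7Entry_two_common : ∀ a b c c' : Fin 7,
    a ≠ b ∧ c ≠ c' ∧ w7Entry a c * w7Entry b c ≠ 0 ∧ w7Entry a c' * w7Entry b c' ≠ 0 →
      w7Entry a c * w7Entry b c + w7Entry a c' * w7Entry b c' = 0 ∧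
        ∀ k, k ≠ c ∧ k ≠ c' → w7Entry a k * w7Entry b k = 0 := by
  decide +kernel

theorem matrixW7_apply (i j : Fin 7) : matrixW7 i j = (w7Entry i j : ℂ) := rfl

/-- Every `UW(7, 4)` agrees with `W₇` up to permutations and unimodular scalings of the rows and
the columns. -/
theorem IsUnitWeighing.exists_scaling {W : Matrix (Fin 7) (Fin 7) ℂ} (h : IsUnitWeighing 4 W) :
    ∃ (τ σ : Equiv.Perm (Fin 7)) (d e : Fin 7 → ℂ), (∀ i, ‖d i‖ = 1) ∧ (∀ j, ‖e j‖ = 1) ∧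
      ∀ i j, W (τ i) (σ j) = d i * matrixW7 i j * e j := by
  classical
  obtain ⟨τ, σ, hz⟩ := exists_fano_labelling (fun i j => W i j = 0) h.card_zeros
    (fun j k hjk => h.exists_common_zero_row hjk)
    (fun i j k l h1 h2 h3 h4 hkl => h.common_zeros_unique h1 h2 h3 h4 hkl)
  -- Entries of `W₇` are their own inverses on the support, so `U` is the entrywise quotient by
  -- `W₇`.
  obtain ⟨U, hU⟩ : ∃ U : Fin 7 → Fin 7 → ℂ,
      ∀ i j, U i j = W (τ i) (σ j) * (w7Entry i j : ℂ) := ⟨_, fun _ _ => rfl⟩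
  have hnorm : ∀ i j, w7Entry i j ≠ 0 → ‖U i j‖ = 1 := by
    intro i j hij
    have h1 : W (τ i) (σ j) ≠ 0 := fun h0 => hij ((hz i j).1 h0)
    rw [hU, norm_mul, h.norm_eq_one h1]
    rcases w7Entry_cases i j with h2 | h2 | h2
    · exact absurd h2 hij
    all_goals simp [h2]
  have hne : ∀ i j, w7Entry i j ≠ 0 → U i j ≠ 0 := fun i j hij =>
    norm_ne_zero_iff.1 (by rw [hnorm i j hij]; exact one_ne_zero)
  -- Orthogonality gives a vanishing 2 × 2 permanent for both `W` and `W₇`; hence their quotient has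
  -- a vanishing 2 × 2 determinant.
  have hcycle : ∀ a b c c', a ≠ b → c ≠ c' →
      (w7Entry a c ≠ 0 ∧ w7Entry b c ≠ 0 ∧ w7Entry a c' ≠ 0 ∧
        w7Entry b c' ≠ 0) → U a c * U b c' = U a c' * U b c := by
    rintro a b c c' hab hcc ⟨h1, h2, h3, h4⟩
    have horth := h.sum_mul_star (τ a) (τ b)
    rw [if_neg (τ.injective.ne hab), ← Equiv.sum_comp σ] at horth
    obtain ⟨hs, ho⟩ := w7Entry_two_common a b c c'
      ⟨hab, hcc, mul_ne_zero h1 h2, mul_ne_zero h3 h4⟩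
    rw [Fintype.sum_eq_add c c' hcc] at horth
    · have hcast : (w7Entry a c : ℂ) * w7Entry b c + w7Entry a c' * w7Entry b c' = 0 := by
        exact_mod_cast hs
      have hsq : ∀ i j, w7Entry i j ≠ 0 → (w7Entry i j : ℂ) * w7Entry i j = 1 := by
        intro i j hij
        rcases w7Entry_cases i j with h | h | h
        · exact absurd h hij
        all_goals simp [h]
      have hu : ∀ i j, w7Entry i j ≠ 0 → W (τ i) (σ j) * star (W (τ i) (σ j)) = 1 :=
        fun i j hij => mul_star_self_of_norm (h.norm_eq_one fun h0 => hij ((hz i j).1 h0))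
      have hP : W (τ a) (σ c) * W (τ b) (σ c') + W (τ a) (σ c') * W (τ b) (σ c) = 0 := by
        linear_combination W (τ b) (σ c) * W (τ b) (σ c') * horth -
          W (τ a) (σ c) * W (τ b) (σ c') * hu b c h2 -
          W (τ a) (σ c') * W (τ b) (σ c) * hu b c' h4
      have hQ : (w7Entry a c : ℂ) * w7Entry b c' + w7Entry a c' * w7Entry b c = 0 := by
        linear_combination (w7Entry b c : ℂ) * w7Entry b c' * hcast -
          (w7Entry a c : ℂ) * w7Entry b c' * hsq b c h2 -
          (w7Entry a c' : ℂ) * w7Entry b c * hsq b c' h4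
      simp only [hU]
      linear_combination W (τ a) (σ c) * W (τ b) (σ c') * hQ -
        (w7Entry a c' : ℂ) * w7Entry b c * hP
    · rintro k ⟨hk, hk'⟩
      rcases mul_eq_zero.1 (ho k ⟨hk, hk'⟩) with h0 | h0
      · simp [(hz a k).2 h0]
      · simp [(hz b k).2 h0]
  have hstep : ∀ (d e : Fin 7 → ℂ) (a b c c' : Fin 7), a ≠ b → c ≠ c' →
      (w7Entry a c ≠ 0 ∧ w7Entry b c ≠ 0 ∧ w7Entry a c' ≠ 0 ∧
        w7Entry b c' ≠ 0) →
      U a c = d a * e c → U a c' = d a * e c' → U b c = d b * e c → U b c' = d b * e c' := by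
    intro d e a b c c' hab hcc hs h1 h2 h3
    have hc := hcycle a b c c' hab hcc hs
    refine mul_left_cancel₀ (hne a c hs.1) ?_
    rw [hc, h1, h2, h3]
    ring
  have key : ∃ d e : Fin 7 → ℂ, (∀ i, ‖d i‖ = 1) ∧ (∀ j, ‖e j‖ = 1) ∧
      ∀ i j, w7Entry i j ≠ 0 → U i j = d i * e j := by
    have n10 := hnorm 1 0 (by decide)
    have n20 := hnorm 2 0 (by decide)
    have n30 := hnorm 3 0 (by decide)
    have n14 := hnorm 1 4 (by decide)
    have n26 := hnorm 2 6 (by decide)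
    have n33 := hnorm 3 3 (by decide)
    have n46 := hnorm 4 6 (by decide)
    have n41 := hnorm 4 1 (by decide)
    have n42 := hnorm 4 2 (by decide)
    have n45 := hnorm 4 5 (by decide)
    have n01 := hnorm 0 1 (by decide)
    have n51 := hnorm 5 1 (by decide)
    have n62 := hnorm 6 2 (by decide)
    -- The 13 positions form a spanning tree of the bipartite graph of rows and columns, so phases
    -- can be solved along it, starting from `e 0 = 1`.
    have tree : ∃ d e : Fin 7 → ℂ, (∀ i, ‖d i‖ = 1) ∧ (∀ j, ‖e j‖ = 1) ∧
        U 1 0 = d 1 * e 0 ∧ U 2 0 = d 2 * e 0 ∧ U 3 0 = d 3 * e 0 ∧ U 1 4 = d 1 * e 4 ∧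
        U 2 6 = d 2 * e 6 ∧ U 3 3 = d 3 * e 3 ∧ U 4 6 = d 4 * e 6 ∧ U 4 1 = d 4 * e 1 ∧
        U 4 2 = d 4 * e 2 ∧ U 4 5 = d 4 * e 5 ∧ U 0 1 = d 0 * e 1 ∧ U 5 1 = d 5 * e 1 ∧
        U 6 2 = d 6 * e 2 := by
      have hquot : ∀ a b : ℂ, ‖a‖ = 1 → ‖b‖ = 1 → ∃ c : ℂ, ‖c‖ = 1 ∧ a = b * c := by
        intro a b ha hb
        have hb0 : b ≠ 0 := norm_ne_zero_iff.1 (by rw [hb]; exact one_ne_zero)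
        exact ⟨b⁻¹ * a, by rw [norm_mul, norm_inv, ha, hb]; norm_num,
          (mul_inv_cancel_left₀ hb0 a).symm⟩
      obtain ⟨e4, he4, q14⟩ := hquot _ _ n14 n10
      obtain ⟨e6, he6, q26⟩ := hquot _ _ n26 n20
      obtain ⟨e3, he3, q33⟩ := hquot _ _ n33 n30
      obtain ⟨d4, hd4, q46⟩ := hquot _ _ n46 he6
      obtain ⟨e1, he1, q41⟩ := hquot _ _ n41 hd4
      obtain ⟨e2, he2, q42⟩ := hquot _ _ n42 hd4
      obtain ⟨e5, he5, q45⟩ := hquot _ _ n45 hd4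
      obtain ⟨d0, hd0, q01⟩ := hquot _ _ n01 he1
      obtain ⟨d5, hd5, q51⟩ := hquot _ _ n51 he1
      obtain ⟨d6, hd6, q62⟩ := hquot _ _ n62 he2
      refine ⟨![d0, U 1 0, U 2 0, U 3 0, d4, d5, d6], ![1, e1, e2, e3, e4, e5, e6],
        ?_, ?_, (mul_one _).symm, (mul_one _).symm, (mul_one _).symm, q14, q26, q33,
        q46.trans (mul_comm _ _), q41, q42, q45, q01.trans (mul_comm _ _),
        q51.trans (mul_comm _ _), q62.trans (mul_comm _ _)⟩
      · intro i
        match i with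
        | 0 => exact hd0
        | 1 => exact n10
        | 2 => exact n20
        | 3 => exact n30
        | 4 => exact hd4
        | 5 => exact hd5
        | 6 => exact hd6
      · intro i
        match i with
        | 0 => exact norm_one
        | 1 => exact he1
        | 2 => exact he2
        | 3 => exact he3
        | 4 => exact he4
        | 5 => exact he5
        | 6 => exact he6
    obtain ⟨d, e, hd, he, q10, q20, q30, q14, q26, q33, q46, q41, q42, q45, q01, q51, q62⟩ := tree
    refine ⟨d, e, hd, he, ?_⟩
    -- The other 15 nonzero positions, each closing a 4-cycle whose other three edges are already
    -- known.
    have q24 := hstep d e 1 2 0 4 (by decide) (by decide) (by decide) q10 q14 q20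
    have q36 := hstep d e 2 3 0 6 (by decide) (by decide) (by decide) q20 q26 q30
    have q02 := hstep d e 4 0 1 2 (by decide) (by decide) (by decide) q41 q42 q01
    have q22 := hstep d e 4 2 6 2 (by decide) (by decide) (by decide) q46 q42 q26
    have q35 := hstep d e 4 3 6 5 (by decide) (by decide) (by decide) q46 q45 q36
    have q56 := hstep d e 4 5 1 6 (by decide) (by decide) (by decide) q41 q46 q51
    have q64 := hstep d e 2 6 2 4 (by decide) (by decide) (by decide) q22 q24 q62
    have q65 := hstep d e 4 6 2 5 (by decide) (by decide) (by decide) q42 q45 q62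
    have q00 := hstep d e 2 0 2 0 (by decide) (by decide) (by decide) q22 q20 q02
    have q03 := hstep d e 3 0 0 3 (by decide) (by decide) (by decide) q30 q33 q00
    have q15 := hstep d e 3 1 0 5 (by decide) (by decide) (by decide) q30 q35 q10
    have q11 := hstep d e 4 1 5 1 (by decide) (by decide) (by decide) q45 q41 q15
    have q53 := hstep d e 0 5 1 3 (by decide) (by decide) (by decide) q01 q03 q51
    have q54 := hstep d e 1 5 1 4 (by decide) (by decide) (by decide) q11 q14 q51
    have q63 := hstep d e 0 6 2 3 (by decide) (by decide) (by decide) q02 q03 q62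
    intro i j hij
    match i, j with
    | 0, 0 => exact q00
    | 0, 1 => exact q01
    | 0, 2 => exact q02
    | 0, 3 => exact q03
    | 0, 4 => exact absurd rfl hij
    | 0, 5 => exact absurd rfl hij
    | 0, 6 => exact absurd rfl hij
    | 1, 0 => exact q10
    | 1, 1 => exact q11
    | 1, 2 => exact absurd rfl hij
    | 1, 3 => exact absurd rfl hij
    | 1, 4 => exact q14
    | 1, 5 => exact q15
    | 1, 6 => exact absurd rfl hij
    | 2, 0 => exact q20
    | 2, 1 => exact absurd rfl hij
    | 2, 2 => exact q22
    | 2, 3 => exact absurd rfl hij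
    | 2, 4 => exact q24
    | 2, 5 => exact absurd rfl hij
    | 2, 6 => exact q26
    | 3, 0 => exact q30
    | 3, 1 => exact absurd rfl hij
    | 3, 2 => exact absurd rfl hij
    | 3, 3 => exact q33
    | 3, 4 => exact absurd rfl hij
    | 3, 5 => exact q35
    | 3, 6 => exact q36
    | 4, 0 => exact absurd rfl hij
    | 4, 1 => exact q41
    | 4, 2 => exact q42
    | 4, 3 => exact absurd rfl hij
    | 4, 4 => exact absurd rfl hij
    | 4, 5 => exact q45
    | 4, 6 => exact q46
    | 5, 0 => exact absurd rfl hij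
    | 5, 1 => exact q51
    | 5, 2 => exact absurd rfl hij
    | 5, 3 => exact q53
    | 5, 4 => exact q54
    | 5, 5 => exact absurd rfl hij
    | 5, 6 => exact q56
    | 6, 0 => exact absurd rfl hij
    | 6, 1 => exact absurd rfl hij
    | 6, 2 => exact q62
    | 6, 3 => exact q63
    | 6, 4 => exact q64
    | 6, 5 => exact q65
    | 6, 6 => exact absurd rfl hij
  obtain ⟨d, e, hd, he, hde⟩ := key
  refine ⟨τ, σ, d, e, hd, he, fun i j => ?_⟩
  rw [matrixW7_apply]
  by_cases h0 : w7Entry i j = 0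
  · simp [(hz i j).2 h0, h0]
  · have h1 := hde i j h0
    rw [hU] at h1
    rcases w7Entry_cases i j with h2 | h2 | h2
    · exact absurd h2 h0
    · rw [h2] at h1 ⊢
      push_cast at h1 ⊢
      linear_combination h1
    · rw [h2] at h1 ⊢
      push_cast at h1 ⊢
      linear_combination -h1

/-! ### Vectors unbiased with `W₇` -/

/-- The weight-four vectors that meet the rows of `W₇` like the rows of an unbiased matrix. -/
theorem vecSupport_eq_and_real_of_norm_dotProduct {y : Fin 7 → ℂ}
    (hy : ∀ j, y j ≠ 0 → ‖y j‖ = 1) (hcard : (vecSupport y).card = 4)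
    (hdot : ∀ i, ‖∑ k, y k * matrixW7 i k‖ = 0 ∨ ‖∑ k, y k * matrixW7 i k‖ = 2 ∨
      ‖∑ k, y k * matrixW7 i k‖ = 4) :
    (∃ i, ∀ k, y k ≠ 0 ↔ w7Entry i k ≠ 0) ∧
      ∀ a b, y a ≠ 0 → y b ≠ 0 → y b = y a ∨ y b = -y a := by
  let T : Fin 7 → Finset (Fin 7) := fun i => Finset.univ.filter fun k => w7Entry i k ≠ 0
  -- If `S` meets some `T i` once, the inner product has modulus 1, which is excluded. Otherwise
  -- every pair in `S` is isolated by some row, which compares those two entries.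
  have hcomb : ∀ S ∈ (Finset.univ : Finset (Fin 7)).powersetCard 4,
      (∃ i, (S ∩ T i).card = 1) ∨ (∃ i, S = T i) ∧
        ∀ a ∈ S, ∀ b ∈ S, a ≠ b → ∃ i, S ∩ T i = {a, b} := by
    decide +kernel
  have hsum : ∀ i, ∑ k, y k * matrixW7 i k = ∑ k ∈ vecSupport y ∩ T i, y k * matrixW7 i k := by
    intro i
    symm
    apply Finset.sum_subset (Finset.subset_univ _)
    intro k _ hk
    simp only [Finset.mem_inter, mem_vecSupport, T, Finset.mem_filter, Finset.mem_univ,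
      true_and, not_and_or, not_not] at hk
    rcases hk with hk | hk
    · simp [hk]
    · simp [matrixW7_apply, hk]
  have hpm : ∀ i, ∀ k ∈ T i, matrixW7 i k = 1 ∨ matrixW7 i k = -1 := by
    intro i k hk
    rcases w7Entry_cases i k with h | h | h
    · simp [T, h] at hk
    · left; simp [matrixW7_apply, h]
    · right; simp [matrixW7_apply, h]
  rcases hcomb (vecSupport y) (Finset.mem_powersetCard.2 ⟨Finset.subset_univ _, hcard⟩) with
    ⟨i, hi⟩ | ⟨⟨i, hi⟩, hpairs⟩
  · exfalso
    obtain ⟨k, hk⟩ := Finset.card_eq_one.1 hi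
    have hkm : k ∈ vecSupport y ∩ T i := by simp [hk]
    have h1 : ‖∑ k, y k * matrixW7 i k‖ = 1 := by
      rw [hsum, hk, Finset.sum_singleton, norm_mul,
        hy k (mem_vecSupport.1 (Finset.mem_inter.1 hkm).1)]
      rcases hpm i k (Finset.mem_inter.1 hkm).2 with h | h <;> simp [h]
    rcases hdot i with h | h | h <;> norm_num [h1] at h
  · refine ⟨⟨i, fun k => ?_⟩, fun a b ha hb => ?_⟩
    · have := Finset.ext_iff.1 hi k
      simpa [mem_vecSupport, T] using this
    · by_cases hab : a = b
      · exact Or.inl (by rw [hab])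
      obtain ⟨i, hi⟩ := hpairs a (mem_vecSupport.2 ha) b (mem_vecSupport.2 hb) hab
      have hpair : ∀ u v : ℂ, ‖u‖ = 1 → ‖v‖ = 1 → (‖u + v‖ = 0 ∨ ‖u + v‖ = 2 ∨ ‖u + v‖ = 4) →
          v = u ∨ v = -u := by
        intro u v hu hv h
        rcases h with h | h | h
        · right
          linear_combination norm_eq_zero.1 h
        · left
          -- Equality in the triangle inequality: the law forces `‖u - v‖ = 0`.
          have h4 := parallelogram_law_with_norm ℝ u v
          rw [hu, hv, h] at h4
          have h5 : ‖u - v‖ = 0 := by nlinarith [norm_nonneg (u - v)]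
          linear_combination -norm_eq_zero.1 h5
        · have := norm_add_le u v
          rw [hu, hv, h] at this
          norm_num at this
      have hma : a ∈ T i := (Finset.mem_inter.1 (hi ▸ (by simp : a ∈ ({a, b} : Finset _)))).2
      have hmb : b ∈ T i := (Finset.mem_inter.1 (hi ▸ (by simp : b ∈ ({a, b} : Finset _)))).2
      have hd := hdot i
      rw [hsum, hi, Finset.sum_pair hab] at hd
      have := hpair (y a * matrixW7 i a) (y b * matrixW7 i b)
        (by rcases hpm i a hma with h | h <;> simp [h, hy a ha])
        (by rcases hpm i b hmb with h | h <;> simp [h, hy b hb]) hd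
      rcases hpm i a hma with h | h <;> rcases hpm i b hmb with h' | h' <;>
        rw [h, h'] at this <;> simp only [mul_one, mul_neg, neg_neg, neg_inj] at this
      · exact this
      · rcases this with h | h
        · exact Or.inr (by rw [← h, neg_neg])
        · exact Or.inl h
      · exact this.symm
      · rcases this with h | h
        · exact Or.inl h
        · exact Or.inr (by rw [← h, neg_neg])

theorem IsUnitWeighing.isWeighingEquiv_matrixW7 {W : Matrix (Fin 7) (Fin 7) ℂ}
    (h : IsUnitWeighing 4 W) : IsWeighingEquiv W matrixW7 := by
  obtain ⟨τ, σ, d, e, hd, he, hW⟩ := h.exists_scaling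
  have hd0 : ∀ i, d i ≠ 0 := fun i => norm_ne_zero_iff.1 (by rw [hd]; exact one_ne_zero)
  have he0 : ∀ i, e i ≠ 0 := fun i => norm_ne_zero_iff.1 (by rw [he]; exact one_ne_zero)
  refine ⟨Matrix.of fun i k => if τ.symm i = k then d k else 0,
    Matrix.of fun k j => if k = σ.symm j then e k else 0, ⟨?_, ?_, ?_⟩, ⟨?_, ?_, ?_⟩, ?_⟩
  · exact fun i => ⟨τ.symm i, by simp [hd0], fun j hj => by simp at hj; exact hj.1.symm⟩
  · refine fun j => ⟨τ j, by simp [hd0], fun i hi => ?_⟩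
    simp at hi
    rw [← hi.1, Equiv.apply_symm_apply]
  · intro i j hij
    simp only [Matrix.of_apply] at hij ⊢
    split_ifs at hij ⊢
    · exact hd j
    · exact absurd rfl hij
  · refine fun i => ⟨σ i, by simp [he0], fun j hj => ?_⟩
    simp at hj
    rw [hj.1, Equiv.apply_symm_apply]
  · exact fun j => ⟨σ.symm j, by simp [he0], fun i hi => by simp at hi; exact hi.1⟩
  · intro i j hij
    simp only [Matrix.of_apply] at hij ⊢
    split_ifs at hij ⊢
    · exact he i
    · exact absurd rfl hij
  · ext i j
    have := hW (τ.symm i) (σ.symm j)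
    simp only [Equiv.apply_symm_apply] at this
    simp [Matrix.mul_apply, this]

/-! ### Unbiased pairs and the explicit family -/

theorem sqrt_natCast_four : ((Real.sqrt (4 : ℕ) : ℝ) : ℂ) = 2 := by
  have : Real.sqrt (4 : ℕ) = 2 := by
    rw [show ((4 : ℕ) : ℝ) = 2 ^ 2 by norm_num]
    exact Real.sqrt_sq (by norm_num)
  rw [this]
  norm_num

theorem IsUnbiased.norm_inner {n : ℕ} {H K : Matrix (Fin n) (Fin n) ℂ} (h : IsUnbiased 4 H K)
    (i j : Fin n) :
    ‖∑ c, H i c * star (K j c)‖ = 0 ∨ ‖∑ c, H i c * star (K j c)‖ = 2 := by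
  obtain ⟨-, -, L, hL, hHK⟩ := h
  have h1 := congrFun (congrFun hHK i) j
  rw [sqrt_natCast_four] at h1
  simp only [Matrix.mul_apply, Matrix.conjTranspose_apply, Matrix.smul_apply, smul_eq_mul] at h1
  rw [h1, norm_mul]
  rcases hL.1 i j with h2 | h2 <;> simp [h2]

/-- Take `L = H K* / 2`: its orthogonality is automatic from `K* K = 4 I`, so only the moduli need
checking. -/
theorem IsUnitWeighing.isUnbiased {n : ℕ} {H K : Matrix (Fin n) (Fin n) ℂ}
    (hH : IsUnitWeighing 4 H) (hK : IsUnitWeighing 4 K)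
    (h : ∀ i j, ‖(H * Kᴴ) i j‖ = 0 ∨ ‖(H * Kᴴ) i j‖ = 2) : IsUnbiased 4 H K := by
  refine ⟨hH, hK, (2 : ℂ)⁻¹ • (H * Kᴴ), ⟨fun i j => ?_, ?_⟩, ?_⟩
  · rw [Matrix.smul_apply, smul_eq_mul, norm_mul]
    rcases h i j with h | h <;> simp [h]
  · have hK' := (hK.conjTranspose (by norm_num)).2
    rw [Matrix.conjTranspose_conjTranspose] at hK'
    rw [Matrix.conjTranspose_smul, Matrix.conjTranspose_mul, Matrix.conjTranspose_conjTranspose,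
      Matrix.smul_mul, Matrix.mul_smul, Matrix.mul_assoc, ← Matrix.mul_assoc Kᴴ, hK',
      Matrix.smul_mul, Matrix.one_mul, Matrix.mul_smul, hH.2]
    simp only [smul_smul]
    congr 1
    norm_num
  · rw [sqrt_natCast_four, smul_smul, mul_inv_cancel₀ (by norm_num), one_smul]

/-- The entries of the eight matrices as integers. -/
def familyEntry (k : Fin 8) (i j : Fin 7) : ℤ := family74Int k i j

theorem family74_apply (k : Fin 8) (i j : Fin 7) : family74 k i j = (familyEntry k i j : ℂ) := rfl

theorem familyEntry_cases : ∀ k i j,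
    familyEntry k i j = 0 ∨ familyEntry k i j = 1 ∨ familyEntry k i j = -1 := by
  decide +kernel

theorem familyEntry_inner_self : ∀ k i j,
    ∑ c, familyEntry k i c * familyEntry k j c = if i = j then 4 else 0 := by
  decide +kernel

theorem familyEntry_inner : ∀ k l, k ≠ l → ∀ i j,
    ∑ c, familyEntry k i c * familyEntry l j c ∈ [0, 2, -2] := by
  decide +kernel

theorem family74_mul_conjTranspose (k l : Fin 8) (i j : Fin 7) :
    (family74 k * (family74 l)ᴴ) i j =
      ((∑ c, familyEntry k i c * familyEntry l j c : ℤ) : ℂ) := by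
  simp [Matrix.mul_apply, family74_apply]

theorem isRealWeighing_family74 (k : Fin 8) : IsRealWeighing 4 (family74 k) := by
  refine ⟨⟨fun i j => ?_, ?_⟩, fun i j => ?_⟩
  · rw [family74_apply]
    rcases familyEntry_cases k i j with h | h | h <;> simp [h]
  · ext i j
    rw [family74_mul_conjTranspose, familyEntry_inner_self]
    by_cases h : i = j <;> simp [h]
  · rw [family74_apply]
    rcases familyEntry_cases k i j with h | h | h <;> simp [h]

theorem isUnbiased_family74 {k l : Fin 8} (h : k ≠ l) :
    IsUnbiased 4 (family74 k) (family74 l) := by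
  refine (isRealWeighing_family74 k).1.isUnbiased (isRealWeighing_family74 l).1 fun i j => ?_
  rw [family74_mul_conjTranspose]
  have := familyEntry_inner k l h i j
  simp only [List.mem_cons, List.not_mem_nil, or_false] at this
  rcases this with h | h | h <;> simp [h]

theorem isMutuallyUnbiased_range_family74 : IsMutuallyUnbiased 4 (Set.range family74) := by
  refine ⟨?_, ?_⟩
  · rintro _ ⟨k, rfl⟩
    exact (isRealWeighing_family74 k).1
  · rintro _ ⟨k, rfl⟩ _ ⟨l, rfl⟩ hne
    exact isUnbiased_family74 fun h => hne (by rw [h])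

/-- Equal members would give a row inner product 4 with itself, whereas distinct indices allow only
0 and ±2. -/
theorem family74_injective : Function.Injective family74 := by
  intro k l hkl
  by_contra hne
  have h1 := familyEntry_inner k l hne 0 0
  have h2 := family74_mul_conjTranspose k l 0 0
  rw [← hkl, family74_mul_conjTranspose, familyEntry_inner_self] at h2
  have h3 : (4 : ℤ) = ∑ c, familyEntry k 0 c * familyEntry l 0 c := by exact_mod_cast h2
  rw [← h3] at h1
  simp at h1

theorem encard_range_family74 : (Set.range family74).encard = 8 := by
  rw [← Set.image_univ, family74_injective.encard_image, Set.encard_univ]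
  simp

theorem star_matrixW7 (i j : Fin 7) : star (matrixW7 i j) = matrixW7 i j := by
  simp [matrixW7_apply]

theorem IsUnbiased.exists_diagonal_mul_isRealWeighing {W : Matrix (Fin 7) (Fin 7) ℂ}
    (h : IsUnbiased 4 W matrixW7) :
    ∃ d : Fin 7 → ℂ, (∀ i, ‖d i‖ = 1) ∧ IsRealWeighing 4 (Matrix.diagonal d * W) := by
  have hW := h.1
  have hreal : ∀ i, ∀ a b, W i a ≠ 0 → W i b ≠ 0 → W i b = W i a ∨ W i b = -W i a := by
    intro i
    refine (vecSupport_eq_and_real_of_norm_dotProduct (fun j hj => hW.norm_eq_one hj)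
      (hW.card_support i) fun j => ?_).2
    have := h.norm_inner i j
    simp only [star_matrixW7] at this
    tauto
  have hex : ∀ i, ∃ a, W i a ≠ 0 := by
    intro i
    obtain ⟨a, ha⟩ := Finset.card_pos.1 (by rw [hW.card_support i]; norm_num :
      0 < (vecSupport (W i)).card)
    exact ⟨a, mem_vecSupport.1 ha⟩
  choose a ha using hex
  have hnorm : ∀ i, ‖star (W i (a i))‖ = 1 := fun i => by
    rw [norm_star, hW.norm_eq_one (ha i)]
  -- This phase turns the chosen nonzero entry of each row into 1.
  refine ⟨fun i => star (W i (a i)), hnorm, ⟨fun i j => ?_, ?_⟩, fun i j => ?_⟩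
  · rw [Matrix.diagonal_mul, norm_mul, hnorm, one_mul]
    exact hW.1 i j
  · rw [Matrix.conjTranspose_mul, Matrix.mul_assoc, ← Matrix.mul_assoc W, hW.2, Matrix.smul_mul,
      Matrix.one_mul, Matrix.mul_smul, Matrix.diagonal_conjTranspose, Matrix.diagonal_mul_diagonal,
      ← Matrix.diagonal_one]
    congr 2
    ext i
    have := mul_star_self_of_norm (hnorm i)
    simpa using this
  · rw [Matrix.diagonal_mul]
    have h1 : star (W i (a i)) * W i (a i) = 1 := by
      rw [mul_comm]
      exact mul_star_self_of_norm (hW.norm_eq_one (ha i))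
    by_cases hj : W i j = 0
    · simp [hj]
    · rcases hreal i (a i) j (ha i) hj with h2 | h2
      · right; left
        rw [h2, h1]
      · right; right
        rw [h2, mul_neg, h1]

/-! ### The upper bound -/

theorem norm_sum_unimodular_phase {n : ℕ} (f : Fin n → ℂ) (d : ℂ) (hd : ‖d‖ = 1) :
    ‖∑ c, d * f c‖ = ‖∑ c, f c‖ := by
  rw [← Finset.mul_sum, norm_mul, hd, one_mul]

/-- A set of mutually unbiased `UW(7, 4)` has at most eight elements: after a transformation that
takes a member to `W₇`, every member has a row supported on the first four columns, and this row
is determined up to a scalar by three signs. -/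
theorem IsMutuallyUnbiased.encard_le {S : Set (Matrix (Fin 7) (Fin 7) ℂ)}
    (hS : IsMutuallyUnbiased 4 S) : S.encard ≤ 8 := by
  rcases S.eq_empty_or_nonempty with rfl | ⟨H, hH⟩
  · simp
  obtain ⟨τ, σ, d, e, hd, he, hHW⟩ := (hS.1 H hH).exists_scaling
  have he0 : ∀ i, e i ≠ 0 := fun i => norm_ne_zero_iff.1 (by rw [he]; exact one_ne_zero)
  -- The value 4 arises from `K = H`, so that `H` is counted along with the other members.
  have hinner : ∀ K ∈ S, ∀ i j,
      ‖∑ c, K i c * star (H j c)‖ = 0 ∨ ‖∑ c, K i c * star (H j c)‖ = 2 ∨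
        ‖∑ c, K i c * star (H j c)‖ = 4 := by
    intro K hK i j
    by_cases hKH : K = H
    · rw [hKH, (hS.1 H hH).sum_mul_star]
      split_ifs <;> simp
    · have := (hS.2 hK hH hKH).norm_inner i j
      tauto
  have hrow : ∀ K ∈ S, ∀ i,
      (∃ l, ∀ k, K i (σ k) ≠ 0 ↔ w7Entry l k ≠ 0) ∧
      ∀ a b, K i (σ a) ≠ 0 → K i (σ b) ≠ 0 →
        K i (σ b) * star (e b) = K i (σ a) * star (e a) ∨
          K i (σ b) * star (e b) = -(K i (σ a) * star (e a)) := by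
    intro K hK i
    have hy0 : ∀ k, K i (σ k) * star (e k) ≠ 0 ↔ K i (σ k) ≠ 0 := by
      intro k
      simp [he0]
    have := vecSupport_eq_and_real_of_norm_dotProduct (y := fun k => K i (σ k) * star (e k))
      (fun j hj => by
        rw [norm_mul, norm_star, he, mul_one]
        exact (hS.1 K hK).norm_eq_one ((hy0 j).1 hj))
      (by
        rw [← (hS.1 K hK).card_support i]
        refine Finset.card_equiv σ fun k => ?_
        rw [mem_vecSupport, mem_vecSupport, hy0])
      (fun j => by
        have h1 := hinner K hK i (τ j)
        rw [← Equiv.sum_comp σ] at h1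
        have h2 : ∀ c, K i (σ c) * star (H (τ j) (σ c)) =
            star (d j) * (K i (σ c) * star (e c) * matrixW7 j c) := by
          intro c
          rw [hHW, star_mul', star_mul', star_matrixW7]
          ring
        simp only [h2] at h1
        rwa [norm_sum_unimodular_phase _ _ (by rw [norm_star, hd])] at h1)
    simp only [hy0] at this
    exact this
  have hsel : ∀ K : S, ∃ i, ∀ k, K.1 i (σ k) ≠ 0 ↔ w7Entry 0 k ≠ 0 := by
    rintro ⟨K, hK⟩
    choose l hl using fun i => (hrow K hK i).1
    -- Two rows of `K` with the same support would meet in 4 positions instead of 2; hence all seven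
    -- supports occur, including that of row 0.
    have hinj : Function.Injective l := by
      intro i j hij
      by_contra hne
      have h1 := (hS.1 K hK).card_inter hne
      have h2 : vecSupport (K i) = vecSupport (K j) := by
        ext k
        obtain ⟨k, rfl⟩ := σ.surjective k
        rw [mem_vecSupport, mem_vecSupport, hl, hl, hij]
      rw [h2, Finset.inter_self, (hS.1 K hK).card_support] at h1
      norm_num at h1
    obtain ⟨i, hi⟩ := Finite.surjective_of_injective hinj 0
    exact ⟨i, hi ▸ hl i⟩
  choose r hr using hsel
  let y : S → Fin 7 → ℂ := fun K k => K.1 (r K) (σ k) * star (e k)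
  have hy0 : ∀ K k, y K k ≠ 0 ↔ w7Entry 0 k ≠ 0 := by
    intro K k
    rw [← hr K k]
    simp [y, he0]
  have hynorm : ∀ K k, w7Entry 0 k ≠ 0 → ‖y K k‖ = 1 := by
    intro K k hk
    simp only [y]
    rw [norm_mul, norm_star, he, mul_one]
    exact (hS.1 K.1 K.2).norm_eq_one ((hr K k).2 hk)
  have hyreal : ∀ K k, w7Entry 0 k ≠ 0 → y K k = y K 0 ∨ y K k = -y K 0 := fun K k hk =>
    (hrow K.1 K.2 (r K)).2 0 k ((hr K 0).2 (by decide)) ((hr K k).2 hk)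
  have hyinner : ∀ K K' : S, ∑ k, y K k * star (y K' k) =
      ∑ c, K.1 (r K) c * star (K'.1 (r K') c) := by
    intro K K'
    rw [← Equiv.sum_comp σ fun c => K.1 (r K) c * star (K'.1 (r K') c)]
    refine Finset.sum_congr rfl fun k _ => ?_
    have := mul_star_self_of_norm (he k)
    simp only [y, star_mul', star_star]
    linear_combination K.1 (r K) (σ k) * star (K'.1 (r K') (σ k)) * this
  -- The signs of entries 1, 2, 3 relative to entry 0.
  let g : S → Set (Fin 3) := fun K => {k | y K k.succ.castSucc.castSucc.castSucc = y K 0}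
  have hg : Function.Injective g := by
    intro K K' hKK
    by_contra hne
    -- Equal signs make the two rows proportional.
    have hprop : ∀ k, y K k * y K' 0 = y K 0 * y K' k := by
      intro k
      by_cases hk : w7Entry 0 k = 0
      · have h1 : y K k = 0 := by
          by_contra h1
          exact (hy0 K k).1 h1 hk
        have h2 : y K' k = 0 := by
          by_contra h2
          exact (hy0 K' k).1 h2 hk
        rw [h1, h2, mul_zero, zero_mul]
      · have hlow : ∀ k : Fin 7, w7Entry 0 k ≠ 0 → k = 0 ∨
            ∃ l : Fin 3, k = l.succ.castSucc.castSucc.castSucc := by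
          decide
        rcases hlow k hk with rfl | ⟨l, rfl⟩
        · rfl
        · have h1 : y K l.succ.castSucc.castSucc.castSucc = y K 0 ↔
              y K' l.succ.castSucc.castSucc.castSucc = y K' 0 := Set.ext_iff.1 hKK l
          rcases hyreal K _ hk with h2 | h2
          · rw [h1.1 h2, h2]
          · rcases hyreal K' _ hk with h3 | h3
            · rw [h1.2 h3, h3]
            · rw [h2, h3]
              ring
    have h4 : ‖∑ k, y K k * star (y K' k)‖ = 4 := by
      have hn : ‖y K' 0‖ = 1 := hynorm K' 0 (by decide)
      have hn' : ‖y K 0‖ = 1 := hynorm K 0 (by decide)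
      -- Multiplying by the unimodular `y K' 0` turns each nonzero term into `y K 0`, so the sum has
      -- modulus 4.
      have h5 : ∀ k, y K' 0 * (y K k * star (y K' k)) = y K 0 * if w7Entry 0 k ≠ 0 then 1 else 0 := by
        intro k
        split_ifs with hk
        · have := mul_star_self_of_norm (hynorm K' k hk)
          linear_combination star (y K' k) * hprop k + y K 0 * this
        · have : y K k = 0 := by
            by_contra h1
            exact hk ((hy0 K k).1 h1)
          simp [this]
      rw [← norm_sum_unimodular_phase _ _ hn]
      simp only [h5]
      rw [norm_sum_unimodular_phase _ _ hn', ← Finset.sum_filter, Finset.sum_const]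
      have : (Finset.univ.filter fun k => w7Entry 0 k ≠ 0).card = 4 := by decide
      rw [this]
      simp
    rw [hyinner] at h4
    rcases (hS.2 K.2 K'.2 fun h => hne (Subtype.ext h)).norm_inner (r K) (r K') with h | h <;>
      · rw [h] at h4
        norm_num at h4
  have hle := Function.Embedding.encard_le (s := S) (t := (Set.univ : Set (Set (Fin 3))))
    ⟨fun K => ⟨g K, Set.mem_univ _⟩, fun K K' h => hg (congrArg Subtype.val h)⟩
  refine hle.trans ?_
  rw [Set.encard_univ]
  simp

theorem realUnbiasedBound_seven_four : realUnbiasedBound 7 4 = 8 := by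
  norm_num [realUnbiasedBound]

theorem mainTheorem3 :
    -- the maximum number of mutually unbiased UW(7,4) is 8
    IsGreatest {k : ℕ∞ | ∃ S : Set (Matrix (Fin 7) (Fin 7) ℂ),
        IsMutuallyUnbiased 4 S ∧ S.encard = k} 8 ∧
    -- W₇ is a real W(7,4), and every UW(7,4) is equivalent to it
    IsRealWeighing 4 matrixW7 ∧
    (∀ W : Matrix (Fin 7) (Fin 7) ℂ, IsUnitWeighing 4 W → IsWeighingEquiv W matrixW7) ∧
    -- a matrix unbiased with W₇ is real, up to unimodular factors on its rows
    (∀ W : Matrix (Fin 7) (Fin 7) ℂ, IsUnbiased 4 W matrixW7 →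
      ∃ d : Fin 7 → ℂ, (∀ i, ‖d i‖ = 1) ∧ IsRealWeighing 4 (Matrix.diagonal d * W)) ∧
    -- the real bound holds for all sets of mutually unbiased UW(7,4), and its value is 8
    (∀ S : Set (Matrix (Fin 7) (Fin 7) ℂ), IsMutuallyUnbiased 4 S →
      S.Finite ∧ (S.ncard : ℝ) ≤ realUnbiasedBound 7 4) ∧
    realUnbiasedBound 7 4 = 8 ∧
    -- the explicit set of eight real W(7,4) attains it
    IsMutuallyUnbiased 4 (Set.range family74) ∧
    (∀ k, IsRealWeighing 4 (family74 k)) ∧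
    (Set.range family74).encard = 8 := by
  refine ⟨⟨⟨_, isMutuallyUnbiased_range_family74, encard_range_family74⟩, ?_⟩,
    isRealWeighing_family74 0, fun W hW => hW.isWeighingEquiv_matrixW7,
    fun W hW => hW.exists_diagonal_mul_isRealWeighing, fun S hS => ?_,
    realUnbiasedBound_seven_four, isMutuallyUnbiased_range_family74, isRealWeighing_family74,
    encard_range_family74⟩
  · rintro k ⟨S, hS, rfl⟩
    exact hS.encard_le
  · have hle := hS.encard_le
    have hfin : S.Finite := Set.finite_of_encard_le_coe (k := 8) hle
    refine ⟨hfin, ?_⟩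
    rw [realUnbiasedBound_seven_four]
    rw [← hfin.cast_ncard_eq] at hle
    exact_mod_cast hle
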